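/- Let $(a)_n=a(a+1)\cdots(a+n-1)$ and let ${}_2F_1(a,b;c;z)=\sum_{n\ge0}\frac{(a)_n(b)_n}{n!\,(c)_n}z^n$. Define $u(n)$ for $n\ge 0$ by the identity of formal power series $$\sum_{n\ge0}\frac{u(n)}{(2n+1)!}t^n=\frac{{}_2F_1\left(\tfrac34,\tfrac34;\tfrac32;4t\right)}{{}_2F_1\left(\tfrac14,\tfrac14;\tfrac12;4t\right)},$$ and set $$s(n,k)=\frac{(2n)!}{(2k)!}\,[z^{2n}]\left(\sum_{j\ge0}\frac{u(j)}{(2j+1)!}z^{2j+1}\right)^{2k}.$$ Let $p\equiv1\pmod 4$ be a prime and put $\Pi(p)=3^27^2\cdots(2p-3)^2=\prod_{i=1}^{(p-1)/2}(4i-1)^2$. Let $n\ge\frac{p+1}{2}$ and let $l$ be any integer. Then the numbers $s(n,k)$, $1\le k\le n$, are integers, and $$\sum_{\substack{1\le k\le n\\ k\equiv l\ (\mathrm{mod}\ (p-1)/2)}}2^{n-k}\,s(n,k)\left(-2^{\frac{p-1}{2}}\,\Pi(p)\right)^{\frac{2(k-l)}{p-1}}\equiv0\pmod p.$$ Here the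 exponents $\frac{2(k-l)}{p-1}$ are integers; negative powers are taken modulo $p$, the base being prime to $p$. -/

import Mathlib

namespace ThetaTaylor

/-- The formal Gauss hypergeometric series `₂F₁(a, b; c; z) = ∑ (a)ₙ (b)ₙ / (n! (c)ₙ) zⁿ` evaluated
at `z = r t`, as a formal power series in `t` over `ℚ`.
The Pochhammer symbol `(x)ₙ = x (x + 1) ⋯ (x + n - 1)` is `(ascPochhammer ℚ n).eval x`. -/
noncomputable def hyp (a b c r : ℚ) : PowerSeries ℚ :=
  PowerSeries.mk fun n =>
    ((ascPochhammer ℚ n).eval a * (ascPochhammer ℚ n).eval b) /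
      ((n.factorial : ℚ) * (ascPochhammer ℚ n).eval c) * r ^ n

/-- The sequence `u(n)`, given by
`∑ u(n) / (2n+1)! tⁿ = ₂F₁(3/4, 3/4; 3/2; 4t) / ₂F₁(1/4, 1/4; 1/2; 4t)`.
The denominator has constant coefficient `1`, so its inverse is the genuine one. -/
noncomputable def u (n : ℕ) : ℚ :=
  ((2 * n + 1).factorial : ℚ) *
    PowerSeries.coeff n (hyp (3 / 4) (3 / 4) (3 / 2) 4 * (hyp (1 / 4) (1 / 4) (1 / 2) 4)⁻¹)

/-- The odd power series `∑ u(j) / (2j+1)! z^(2j+1)`. -/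
noncomputable def uSeries : PowerSeries ℚ :=
  PowerSeries.mk fun m => if Odd m then u ((m - 1) / 2) / (m.factorial : ℚ) else 0

/-- The numbers `s(n, k) = (2n)! / (2k)! [z^(2n)] (∑ u(j) / (2j+1)! z^(2j+1))^(2k)`. -/
noncomputable def s (n k : ℕ) : ℚ :=
  ((2 * n).factorial : ℚ) / ((2 * k).factorial : ℚ) *
    PowerSeries.coeff (2 * n) (uSeries ^ (2 * k))

/-- `Π(p) = 3² 7² ⋯ (2p-3)² = ∏_{i=1}^{(p-1)/2} (4i-1)²`. -/
def bigPi (p : ℕ) : ℤ :=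
  ∏ i ∈ Finset.Icc 1 ((p - 1) / 2), (4 * (i : ℤ) - 1) ^ 2

end ThetaTaylor

/-!
The series `f = ∑ u(j) / (2j+1)! z^(2j+1)` is the quotient of two solutions of the differential
equation `y'' = (2 z d/dz + 1)² y`, so its exponential coefficients are integers, and `s(n, k)` is
the exponential coefficient of `z^(2n)` in the divided power `f^(2k) / (2k)!`.

Modulo `p` the operator `Dᵖ = (d/dz)ᵖ` is a derivation and maps solutions of the equation to
solutions. For `p ≡ 1 (mod 4)` it kills the denominator of `f` and maps the numerator to `Π(p)`
times the denominator, so `Dᵖ f = Π(p)`. Since `f(0) = 0` and `f'(0) = 1`, it follows by induction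
on `m` that `Dᵖ (f^m / m!) = Π(p) f^(m-1) / (m-1)! + f^(m-p) / (m-p)!`, where the last term is
absent for `m < p`. Up to the factor `Π(p)`, the two terms for `m = 2k` are the same expression in
`k` and in `k - (p-1)/2`, and with the weights of the congruence the sum telescopes.
-/

open Finset
open scoped PowerSeries

section PrimePower

variable {R A : Type*} [CommRing R] [CommRing A] [Algebra R A] (D : Derivation R A A)

theorem iterate_derivation_mul (n : ℕ) (x y : A) :
    D^[n] (x * y) = ∑ ij ∈ antidiagonal n, (n.choose ij.1 : A) * (D^[ij.1] x * D^[ij.2] y) := by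
  induction n with
  | zero => simp
  | succ n ih =>
    rw [sum_antidiagonal_choose_succ_mul (fun i j ↦ D^[i] x * D^[j] y), ← sum_add_distrib,
      Function.iterate_succ_apply', ih, map_sum]
    refine sum_congr rfl fun ij hij ↦ ?_
    rw [← Nat.choose_symm_of_eq_add (HasAntidiagonal.mem_antidiagonal.1 hij).symm,
      Derivation.leibniz, Derivation.leibniz, Derivation.map_natCast]
    simp only [Function.iterate_succ_apply', smul_eq_mul]
    ring

theorem iterate_prime_derivation_mul (p : ℕ) [Fact p.Prime] [CharP A p] (x y : A) :
    D^[p] (x * y) = x * D^[p] y + y * D^[p] x := by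
  have hp := Fact.out (p := p.Prime)
  rw [iterate_derivation_mul, sum_eq_add_of_mem (0, p) (p, 0) (by simp) (by simp)
    (by simp [hp.ne_zero])]
  · simp [mul_comm]
  · rintro ⟨i, j⟩ hij ⟨h0, hn⟩
    have hij : i + j = p := HasAntidiagonal.mem_antidiagonal.1 hij
    have : p ∣ p.choose i := hp.dvd_choose_self (by grind) (by grind)
    simp [(CharP.cast_eq_zero_iff A p _).2 this]

/-- In characteristic `p` the `p`-th iterate of a derivation is again a derivation. -/
def primePowDerivation (p : ℕ) [Fact p.Prime] [CharP A p] : Derivation R A A :=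
  Derivation.mk' ((D : A →ₗ[R] A) ^ p) fun x y ↦ by
    simpa [Module.End.pow_apply] using iterate_prime_derivation_mul D p x y

theorem primePowDerivation_apply (p : ℕ) [Fact p.Prime] [CharP A p] (x : A) :
    primePowDerivation D p x = D^[p] x := by
  simp [primePowDerivation, Module.End.pow_apply]

end PrimePower

/-- Keigher's ring of Hurwitz series: a sequence `x` stands for the exponential generating series
`∑ x n / n! zⁿ`, so that differentiation, integration and divided powers make sense over every
commutative ring. -/
def HurwitzSeries (R : Type*) : Type _ := ℕ → R

namespace HurwitzSeries

variable {R S : Type*} [CommRing R] [CommRing S]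

instance : AddCommGroup (HurwitzSeries R) := inferInstanceAs (AddCommGroup (ℕ → R))

instance : Module R (HurwitzSeries R) := inferInstanceAs (Module R (ℕ → R))

/-- The exponential coefficient `n! [zⁿ]`, that is, the `n`-th entry of the sequence. -/
def coeff (n : ℕ) : HurwitzSeries R →ₗ[R] R := LinearMap.proj n

/-- The Hurwitz series with the given exponential coefficients. -/
def mk (a : ℕ → R) : HurwitzSeries R := a

@[simp]
theorem coeff_mk (a : ℕ → R) (n : ℕ) : coeff n (mk a) = a n := rfl

@[ext]
theorem ext {x y : HurwitzSeries R} (h : ∀ n, coeff n x = coeff n y) : x = y := funext h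

/-- Differentiation, as a linear map; see `derivative` for the derivation. -/
def shift : HurwitzSeries R →ₗ[R] HurwitzSeries R := LinearMap.funLeft R R Nat.succ

theorem coeff_shift (n : ℕ) (x : HurwitzSeries R) : coeff n (shift x) = coeff (n + 1) x := rfl

instance : One (HurwitzSeries R) := ⟨fun n ↦ if n = 0 then 1 else 0⟩

theorem coeff_one (n : ℕ) : coeff n (1 : HurwitzSeries R) = if n = 0 then 1 else 0 := rfl

theorem shift_one : shift (1 : HurwitzSeries R) = 0 := rfl

instance : Mul (HurwitzSeries R) :=
  ⟨fun x y n ↦ ∑ ij ∈ antidiagonal n, (n.choose ij.1 : R) * (coeff ij.1 x * coeff ij.2 y)⟩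

theorem coeff_mul (n : ℕ) (x y : HurwitzSeries R) : coeff n (x * y) =
    ∑ ij ∈ antidiagonal n, (n.choose ij.1 : R) * (coeff ij.1 x * coeff ij.2 y) := rfl

theorem coeff_zero_mul (x y : HurwitzSeries R) : coeff 0 (x * y) = coeff 0 x * coeff 0 y := by
  simp [coeff_mul]

theorem shift_mul (x y : HurwitzSeries R) : shift (x * y) = shift x * y + x * shift y := by
  ext n
  rw [coeff_shift, coeff_mul, sum_antidiagonal_choose_succ_mul fun i j ↦ coeff i x * coeff j y,
    add_comm, map_add, coeff_mul, coeff_mul]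
  congr 1
  refine sum_congr rfl fun ij hij ↦ ?_
  rw [← Nat.choose_symm_of_eq_add (HasAntidiagonal.mem_antidiagonal.1 hij).symm]
  rfl

theorem coeff_succ_mul (n : ℕ) (x y : HurwitzSeries R) :
    coeff (n + 1) (x * y) = coeff n (shift x * y) + coeff n (x * shift y) := by
  rw [← coeff_shift, shift_mul, map_add]

protected theorem add_mul (x y z : HurwitzSeries R) : (x + y) * z = x * z + y * z := by
  ext n
  simp only [coeff_mul, map_add, add_mul, mul_add, sum_add_distrib]

protected theorem mul_comm (x y : HurwitzSeries R) : x * y = y * x := by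
  ext n
  induction n generalizing x y with
  | zero => simp only [coeff_zero_mul, mul_comm]
  | succ n ih => rw [coeff_succ_mul, coeff_succ_mul, ih, ih x, add_comm]

protected theorem mul_add (x y z : HurwitzSeries R) : x * (y + z) = x * y + x * z := by
  simp only [HurwitzSeries.mul_comm x, HurwitzSeries.add_mul]

protected theorem mul_assoc (x y z : HurwitzSeries R) : x * y * z = x * (y * z) := by
  ext n
  induction n generalizing x y z with
  | zero => simp only [coeff_zero_mul, mul_assoc]
  | succ n ih =>
    simp only [coeff_succ_mul, shift_mul, HurwitzSeries.add_mul, HurwitzSeries.mul_add, map_add,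
      ih, add_assoc]

protected theorem zero_mul (x : HurwitzSeries R) : 0 * x = 0 := by
  ext n
  simp [coeff_mul]

protected theorem one_mul (x : HurwitzSeries R) : 1 * x = x := by
  ext n
  induction n generalizing x with
  | zero => simp [coeff_zero_mul, coeff_one]
  | succ n ih =>
    rw [coeff_succ_mul, shift_one, HurwitzSeries.zero_mul, map_zero, zero_add, ih, coeff_shift]

instance : CommRing (HurwitzSeries R) where
  __ := (inferInstance : AddCommGroup (HurwitzSeries R))
  left_distrib := HurwitzSeries.mul_add
  right_distrib := HurwitzSeries.add_mul
  zero_mul := HurwitzSeries.zero_mul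
  mul_zero x := by rw [HurwitzSeries.mul_comm, HurwitzSeries.zero_mul]
  mul_assoc := HurwitzSeries.mul_assoc
  mul_comm := HurwitzSeries.mul_comm
  one_mul := HurwitzSeries.one_mul
  mul_one x := by rw [HurwitzSeries.mul_comm, HurwitzSeries.one_mul]

protected theorem smul_mul (a : R) (x y : HurwitzSeries R) : a • x * y = a • (x * y) := by
  ext n
  simp only [coeff_mul, map_smul, smul_eq_mul, mul_sum]
  exact sum_congr rfl fun _ _ ↦ by ring

instance : Algebra R (HurwitzSeries R) :=
  Algebra.ofModule HurwitzSeries.smul_mul fun a x y ↦ by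
    rw [mul_comm, HurwitzSeries.smul_mul, mul_comm]

theorem coeff_zero_algebraMap (a : R) : coeff 0 (algebraMap R (HurwitzSeries R) a) = a := by
  rw [Algebra.algebraMap_eq_smul_one, map_smul, coeff_one, if_pos rfl, smul_eq_mul, mul_one]

instance (p : ℕ) [CharP R p] : CharP (HurwitzSeries R) p :=
  charP_of_injective_algebraMap (R := R)
    (Function.LeftInverse.injective (g := coeff 0) coeff_zero_algebraMap) p

/-- The coefficients of the inverse of a Hurwitz series with constant coefficient `u`, by the
recursion that solves `y * x = 1` for the last coefficient of `y`. -/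
def invCoeff (x : HurwitzSeries R) (u : Rˣ) : ℕ → R
  | 0 => ↑u⁻¹
  | n + 1 => -↑u⁻¹ * ∑ k : Fin (n + 1),
      ((n + 1).choose k : R) * (invCoeff x u k * coeff (n + 1 - k) x)

theorem mk_invCoeff_mul {x : HurwitzSeries R} {u : Rˣ} (hx : coeff 0 x = u) :
    mk (invCoeff x u) * x = 1 := by
  ext n
  cases n with
  | zero => simp [coeff_zero_mul, coeff_one, hx, invCoeff]
  | succ n =>
    rw [coeff_mul, Nat.sum_antidiagonal_eq_sum_range_succ
      fun i j ↦ ((n + 1).choose i : R) * (coeff i (mk (invCoeff x u)) * coeff j x),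
      sum_range_succ, sum_range, coeff_mk, invCoeff, Nat.sub_self, hx]
    simp [coeff_one, mul_right_comm _ _ (u : R)]

theorem isUnit_iff {x : HurwitzSeries R} : IsUnit x ↔ IsUnit (coeff 0 x) := by
  refine ⟨fun h ↦ ?_, fun ⟨u, hu⟩ ↦ IsUnit.of_mul_eq_one_right _ (mk_invCoeff_mul hu.symm)⟩
  obtain ⟨y, hy⟩ := h.exists_right_inv
  exact .of_mul_eq_one (coeff 0 y) (by rw [← coeff_zero_mul, hy, coeff_one, if_pos rfl])

/-- Differentiation of exponential generating series. -/
def derivative : Derivation R (HurwitzSeries R) (HurwitzSeries R) :=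
  Derivation.mk' shift fun x y ↦ by
    rw [shift_mul, smul_eq_mul, smul_eq_mul, mul_comm y, add_comm]

theorem coeff_derivative (n : ℕ) (x : HurwitzSeries R) :
    coeff n (derivative x) = coeff (n + 1) x := rfl

theorem coeff_iterate_derivative (k n : ℕ) (x : HurwitzSeries R) :
    coeff n (derivative^[k] x) = coeff (n + k) x := by
  induction k generalizing n with
  | zero => rfl
  | succ k ih => rw [Function.iterate_succ_apply', coeff_derivative, ih, add_right_comm, add_assoc]

theorem ext_derivative {x y : HurwitzSeries R} (h0 : coeff 0 x = coeff 0 y)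
    (h : derivative x = derivative y) : x = y := by
  ext n
  cases n with
  | zero => exact h0
  | succ n => rw [← coeff_derivative, h, coeff_derivative]

/-- The antiderivative with constant coefficient `0`. -/
def integral (x : HurwitzSeries R) : HurwitzSeries R
  | 0 => 0
  | n + 1 => coeff n x

theorem coeff_zero_integral (x : HurwitzSeries R) : coeff 0 (integral x) = 0 := rfl

theorem derivative_integral (x : HurwitzSeries R) : derivative (integral x) = x := rfl

section Map

variable (φ : R →+* S)

/-- Coefficientwise application of a ring homomorphism. -/
def map : HurwitzSeries R →+* HurwitzSeries S where
  toFun x := mk fun n ↦ φ (coeff n x)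
  map_zero' := by ext; simp
  map_add' _ _ := by ext; simp
  map_one' := by ext n; simp [coeff_one, apply_ite φ]
  map_mul' _ _ := by ext; simp [coeff_mul]

theorem coeff_map (n : ℕ) (x : HurwitzSeries R) : coeff n (map φ x) = φ (coeff n x) := rfl

theorem map_derivative (x : HurwitzSeries R) : map φ (derivative x) = derivative (map φ x) := rfl

theorem map_integral (x : HurwitzSeries R) : map φ (integral x) = integral (map φ x) :=
  ext_derivative (by rw [coeff_map, coeff_zero_integral, coeff_zero_integral, map_zero])
    (by rw [← map_derivative, derivative_integral, derivative_integral])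

end Map

/-- The series `∑ aₙ zⁿ`, written as `∑ (n! aₙ) zⁿ / n!`. -/
noncomputable def ofPowerSeries : R⟦X⟧ →+* HurwitzSeries R where
  toFun f := mk fun n ↦ n.factorial * PowerSeries.coeff n f
  map_zero' := by ext; simp
  map_add' _ _ := by ext; simp [mul_add]
  map_one' := by ext n; cases n <;> simp [coeff_one, PowerSeries.coeff_one]
  map_mul' f g := by
    ext n
    rw [coeff_mk, coeff_mul, PowerSeries.coeff_mul, mul_sum]
    refine sum_congr rfl fun ij hij ↦ ?_
    rw [← HasAntidiagonal.mem_antidiagonal.1 hij, ← Nat.add_choose_mul_factorial_mul_factorial,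
      Nat.choose_symm_add]
    push_cast [coeff_mk]
    ring

theorem coeff_ofPowerSeries (n : ℕ) (f : R⟦X⟧) :
    coeff n (ofPowerSeries f) = n.factorial * PowerSeries.coeff n f := rfl

section DividedPower

/-- The divided power `xᵐ / m!` of a series without constant term. It is obtained by integrating
`(xᵐ⁺¹ / (m+1)!)' = x' · xᵐ / m!`, hence needs no division. For `coeff 0 x ≠ 0` it is the divided
power of `x - coeff 0 x`. -/
def dividedPower (x : HurwitzSeries R) : ℕ → HurwitzSeries R
  | 0 => 1
  | m + 1 => integral (derivative x * dividedPower x m)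

variable (x : HurwitzSeries R) (m : ℕ)

theorem dividedPower_zero : dividedPower x 0 = 1 := rfl

theorem derivative_dividedPower_succ :
    derivative (dividedPower x (m + 1)) = derivative x * dividedPower x m :=
  derivative_integral _

theorem coeff_zero_dividedPower_succ : coeff 0 (dividedPower x (m + 1)) = 0 :=
  coeff_zero_integral _

theorem coeff_succ_dividedPower_succ (n : ℕ) : coeff (n + 1) (dividedPower x (m + 1)) =
    coeff n (derivative x * dividedPower x m) := rfl

theorem map_dividedPower (φ : R →+* S) :
    map φ (dividedPower x m) = dividedPower (map φ x) m := by
  induction m with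
  | zero => exact map_one _
  | succ m ih => rw [dividedPower, map_integral, map_mul, map_derivative, ih, dividedPower]

theorem coeff_dividedPower_of_lt {n m : ℕ} (h : n < m) : coeff n (dividedPower x m) = 0 := by
  induction m generalizing n with
  | zero => omega
  | succ m ih =>
    cases n with
    | zero => rfl
    | succ n =>
      rw [coeff_succ_dividedPower_succ, coeff_mul]
      refine sum_eq_zero fun ij hij ↦ ?_
      rw [ih (by grind [HasAntidiagonal.mem_antidiagonal]), mul_zero, mul_zero]

theorem coeff_dividedPower_self : coeff m (dividedPower x m) = coeff 1 x ^ m := by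
  induction m with
  | zero => simp [dividedPower_zero, coeff_one]
  | succ m ih =>
    rw [coeff_succ_dividedPower_succ, coeff_mul, sum_eq_single_of_mem (0, m) (by simp)]
    · simp [ih, coeff_derivative, pow_succ']
    · intro ij hij hne
      rw [coeff_dividedPower_of_lt x (by grind [HasAntidiagonal.mem_antidiagonal]), mul_zero,
        mul_zero]

variable {x} (hx : coeff 0 x = 0)
include hx

theorem dividedPower_one : dividedPower x 1 = x :=
  ext_derivative hx.symm (by rw [derivative_dividedPower_succ, dividedPower_zero, mul_one])

theorem factorial_nsmul_dividedPower : m.factorial • dividedPower x m = x ^ m := by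
  induction m with
  | zero => simp [dividedPower_zero]
  | succ m ih =>
    apply ext_derivative
    · simp [coeff_zero_mul, coeff_zero_dividedPower_succ, pow_succ, hx]
    · rw [map_nsmul, derivative_dividedPower_succ, Derivation.leibniz_pow, Nat.factorial_succ,
        Nat.add_sub_cancel, ← ih, mul_smul, ← mul_smul_comm, smul_eq_mul, mul_comm]

end DividedPower

section Prime

variable (p : ℕ) [Fact p.Prime] [CharP R p] {x : HurwitzSeries R} (hx : coeff 0 x = 0)
include hx

theorem coeff_prime_dividedPower {m : ℕ} (hm : 2 ≤ m) :
    coeff p (dividedPower x m) = if m = p then coeff 1 x ^ p else 0 := by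
  rcases lt_trichotomy m p with h | rfl | h
  · rw [if_neg h.ne]
    -- `Dᵖ` is a derivation, so `Dᵖ (xᵐ)` is a multiple of `xᵐ⁻¹`, and `m!` is invertible
    have hunit : IsUnit (m.factorial : R) := (IsUnit.natCast_factorial_iff_of_charP p).2 h
    have hpow : coeff 0 (derivative^[p] (x ^ m)) = 0 := by
      rw [← primePowDerivation_apply, Derivation.leibniz_pow, map_nsmul, smul_eq_mul,
        coeff_zero_mul, show m - 1 = m - 2 + 1 by omega, pow_succ, coeff_zero_mul, hx, mul_zero,
        zero_mul, smul_zero]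
    rwa [← factorial_nsmul_dividedPower m hx, coeff_iterate_derivative, zero_add, map_nsmul,
      nsmul_eq_mul, hunit.mul_right_eq_zero] at hpow
  · rw [if_pos rfl, coeff_dividedPower_self]
  · rw [if_neg h.ne', coeff_dividedPower_of_lt x h]

theorem iterate_prime_derivative_dividedPower (m : ℕ) :
    derivative^[p] (dividedPower x (m + 1)) = derivative^[p] x * dividedPower x m +
      if p ≤ m + 1 then coeff 1 x ^ p • dividedPower x (m + 1 - p) else 0 := by
  have hp := (Fact.out : p.Prime).two_le
  induction m with
  | zero => rw [dividedPower_one hx, dividedPower_zero, mul_one, if_neg (by omega), add_zero]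
  | succ m ih =>
    apply ext_derivative
    · rw [coeff_iterate_derivative, zero_add, coeff_prime_dividedPower p hx (by omega), map_add,
        coeff_zero_mul, coeff_zero_dividedPower_succ, mul_zero, zero_add]
      rcases lt_trichotomy (m + 2) p with h | rfl | h
      · rw [if_neg h.ne, if_neg (by omega), map_zero]
      · simp [dividedPower_zero, coeff_one]
      · rw [if_neg h.ne', if_pos (by omega), Nat.sub_add_comm (by omega), map_smul,
          coeff_zero_dividedPower_succ, smul_zero]
    · have hcomm (y : HurwitzSeries R) :
          derivative (derivative^[p] y) = derivative^[p] (derivative y) :=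
        (Function.Commute.iterate_self derivative p y).symm
      have hshift : derivative (if p ≤ m + 1 + 1 then
          coeff 1 x ^ p • dividedPower x (m + 1 + 1 - p) else 0) =
          derivative x * if p ≤ m + 1 then coeff 1 x ^ p • dividedPower x (m + 1 - p) else 0 := by
        rcases lt_trichotomy (m + 2) p with h | h | h
        · rw [if_neg (by omega), if_neg (by omega), map_zero, mul_zero]
        · rw [if_pos h.ge, if_neg (by omega), h, Nat.sub_self, dividedPower_zero,
            Derivation.map_smul, Derivation.map_one_eq_zero, smul_zero, mul_zero]
        · rw [if_pos h.le, if_pos (by omega), Nat.sub_add_comm (by omega), Derivation.map_smul,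
            derivative_dividedPower_succ, mul_smul_comm]
      rw [hcomm, derivative_dividedPower_succ, iterate_prime_derivation_mul, ih, map_add, hshift,
        Derivation.leibniz, derivative_dividedPower_succ, hcomm, smul_eq_mul, smul_eq_mul]
      ring

end Prime

end HurwitzSeries

theorem sum_mul_add_shift_eq_zero {R : Type*} [CommRing R] {P : R} {t v : ℕ → R} {h n : ℕ}
    (hn : h ≤ n) (hv : ∀ k, k + h ≤ n → v (k + h) = -P * v k) (ht : ∀ k, n - h < k → t k = 0) :
    ∑ k ∈ Icc 1 n, v k * (P * t k + if h < k then t (k - h) else 0) = 0 := by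
  have hshift : ∑ k ∈ Icc 1 n, v k * (if h < k then t (k - h) else 0) =
      ∑ k ∈ Icc 1 (n - h), v (k + h) * t k := by
    simp only [mul_ite, mul_zero]
    rw [← sum_filter, show {k ∈ Icc 1 n | h < k} = Icc (1 + h) (n - h + h) by grind,
      ← map_add_right_Icc, sum_map]
    simp only [addRightEmbedding_apply, Nat.add_sub_cancel]
  have hcut : ∑ k ∈ Icc 1 n, v k * (P * t k) = ∑ k ∈ Icc 1 (n - h), v k * (P * t k) :=
    (sum_subset (Icc_subset_Icc_right (n.sub_le h)) fun k _ hk ↦ by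
      rw [ht k (by grind), mul_zero, mul_zero]).symm
  simp only [mul_add]
  rw [sum_add_distrib, hcut, hshift, ← sum_add_distrib]
  refine sum_eq_zero fun k hk ↦ ?_
  rw [hv k (by grind)]
  ring

namespace HurwitzSeries

variable {R : Type*} [CommRing R]

theorem sum_mul_coeff_dividedPower_eq_zero {p h : ℕ} [Fact p.Prime] [CharP R p]
    (hp : p = 2 * h + 1) {x : HurwitzSeries R} (hx0 : coeff 0 x = 0) (hx1 : coeff 1 x = 1) {P : R}
    (hx : derivative^[p] x = P • 1) {n : ℕ} (hn : h < n) {v : ℕ → R}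
    (hv : ∀ k, k + h ≤ n → v (k + h) = -P * v k) :
    ∑ k ∈ Icc 1 n, v k * coeff (2 * n) (dividedPower x (2 * k)) = 0 := by
  have hcoeff : ∀ k ∈ Icc 1 n, coeff (2 * n) (dividedPower x (2 * k)) =
      P * coeff (2 * n - p) (dividedPower x (2 * k - 1)) +
        if h < k then coeff (2 * n - p) (dividedPower x (2 * (k - h) - 1)) else 0 := by
    intro k hk
    have hk : 1 ≤ k := (mem_Icc.1 hk).1
    have hderiv := congrArg (coeff (2 * n - p))
      (iterate_prime_derivative_dividedPower p hx0 (2 * k - 1))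
    rw [coeff_iterate_derivative, Nat.sub_add_cancel (by omega), Nat.sub_add_cancel (by omega),
      hx, hx1, one_pow, one_smul, smul_mul_assoc, one_mul, map_add, map_smul, smul_eq_mul,
      apply_ite (coeff _), map_zero] at hderiv
    rw [hderiv, show 2 * k - p = 2 * (k - h) - 1 by omega]
    exact congrArg _ (if_congr (by omega) rfl rfl)
  rw [sum_congr rfl fun k hk ↦ by rw [hcoeff k hk]]
  exact sum_mul_add_shift_eq_zero (t := fun k ↦ coeff (2 * n - p) (dividedPower x (2 * k - 1)))
    hn.le hv fun k hk ↦ coeff_dividedPower_of_lt x (by omega)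

end HurwitzSeries

namespace ThetaTaylor

open HurwitzSeries

section Solution

variable {R S : Type*} [CommRing R] [CommRing S]

/-- The solution of the differential equation `y'' = (2 z d/dz + 1)² y` with `y(0) = a` and
`y'(0) = b`. The solutions with `(a, b) = (1, 0)` and `(a, b) = (0, 1)` are
`₂F₁(1/4, 1/4; 1/2; 4z²)` and `z ₂F₁(3/4, 3/4; 3/2; 4z²)`. -/
def solution (a b : R) : HurwitzSeries R
  | 0 => a
  | 1 => b
  | n + 2 => (2 * n + 1) ^ 2 * solution a b n

theorem coeff_zero_solution (a b : R) : coeff 0 (solution a b) = a := rfl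

theorem coeff_one_solution (a b : R) : coeff 1 (solution a b) = b := rfl

theorem coeff_add_two_solution (a b : R) (n : ℕ) :
    coeff (n + 2) (solution a b) = (2 * n + 1) ^ 2 * coeff n (solution a b) := rfl

theorem eq_solution {x : HurwitzSeries R} {a b : R} (h0 : coeff 0 x = a) (h1 : coeff 1 x = b)
    (h : ∀ n, coeff (n + 2) x = (2 * n + 1) ^ 2 * coeff n x) : x = solution a b := by
  ext n
  induction n using Nat.twoStepInduction with
  | zero => exact h0
  | one => exact h1
  | more n ih _ => rw [h, ih, coeff_add_two_solution]

theorem map_solution (φ : R →+* S) (a b : R) : map φ (solution a b) = solution (φ a) (φ b) :=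
  eq_solution rfl rfl fun n ↦ by
    rw [coeff_map, coeff_map, coeff_add_two_solution]
    simp only [map_mul, map_pow, map_add, map_ofNat, map_natCast, map_one]

theorem smul_solution (c a b : R) : c • solution a b = solution (c * a) (c * b) :=
  eq_solution rfl rfl fun n ↦ by
    rw [map_smul, map_smul, coeff_add_two_solution, smul_eq_mul, smul_eq_mul, mul_left_comm]

theorem coeff_even_solution (a b : R) (m : ℕ) :
    coeff (2 * m) (solution a b) = (∏ i ∈ range m, (4 * (i : R) + 1) ^ 2) * a := by
  induction m with
  | zero => simp [coeff_zero_solution]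
  | succ m ih =>
    rw [mul_add_one, coeff_add_two_solution, ih, prod_range_succ]
    push_cast
    ring

theorem coeff_odd_solution (a b : R) (m : ℕ) :
    coeff (2 * m + 1) (solution a b) = (∏ i ∈ range m, (4 * (i : R) + 3) ^ 2) * b := by
  induction m with
  | zero => simp [coeff_one_solution]
  | succ m ih =>
    rw [mul_add_one, add_right_comm, coeff_add_two_solution, ih, prod_range_succ]
    push_cast
    ring

theorem iterate_derivative_solution (p : ℕ) [CharP R p] (a b : R) :
    derivative^[p] (solution a b) =
      solution (coeff p (solution a b)) (coeff (p + 1) (solution a b)) := by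
  refine eq_solution ?_ ?_ fun n ↦ ?_
  · rw [coeff_iterate_derivative, zero_add]
  · rw [coeff_iterate_derivative, add_comm]
  · rw [coeff_iterate_derivative, coeff_iterate_derivative, add_right_comm, coeff_add_two_solution,
      Nat.cast_add, CharP.cast_eq_zero R p, add_zero]

theorem isUnit_solution_one (b : R) : IsUnit (solution 1 b) :=
  isUnit_iff.2 isUnit_one

theorem bigPi_eq_prod_range (p : ℕ) :
    bigPi p = ∏ i ∈ range ((p - 1) / 2), (4 * (i : ℤ) + 3) ^ 2 := by
  rw [bigPi, ← Ico_add_one_right_eq_Icc, prod_Ico_eq_prod_range, Nat.add_sub_cancel]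
  refine prod_congr rfl fun i _ ↦ ?_
  push_cast
  ring

section CharP

variable {p : ℕ} [CharP R p]

theorem iterate_derivative_solution_one_zero (hp : p % 4 = 1) :
    derivative^[p] (solution (1 : R) 0) = 0 := by
  have hodd : coeff p (solution (1 : R) 0) = 0 := by
    rw [show p = 2 * (p / 2) + 1 by omega, coeff_odd_solution, mul_zero]
  have heven : coeff (p + 1) (solution (1 : R) 0) = 0 := by
    have hfactor : (4 * (p / 4 : ℕ) + 1 : R) ^ 2 = 0 := by
      have hpR : ((4 * (p / 4) + 1 : ℕ) : R) = 0 := by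
        rw [show 4 * (p / 4) + 1 = p by omega, CharP.cast_eq_zero]
      rw [← zero_pow two_ne_zero, ← hpR]
      push_cast
      rfl
    rw [show p + 1 = 2 * ((p + 1) / 2) by omega, coeff_even_solution,
      prod_eq_zero (i := p / 4) (mem_range.2 (by omega)) hfactor, zero_mul]
  rw [iterate_derivative_solution, hodd, heven]
  simpa using (smul_solution (0 : R) 0 0).symm

theorem iterate_derivative_solution_zero_one (hp : p % 2 = 1) :
    derivative^[p] (solution (0 : R) 1) = (bigPi p : R) • solution 1 0 := by
  have hodd : coeff p (solution (0 : R) 1) = bigPi p := by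
    conv_lhs => rw [show p = 2 * ((p - 1) / 2) + 1 by omega]
    rw [coeff_odd_solution, mul_one, bigPi_eq_prod_range]
    push_cast
    rfl
  have heven : coeff (p + 1) (solution (0 : R) 1) = 0 := by
    rw [show p + 1 = 2 * ((p + 1) / 2) by omega, coeff_even_solution, mul_zero]
  rw [iterate_derivative_solution, hodd, heven, smul_solution, mul_one, mul_zero]

theorem iterate_derivative_of_solution_eq_mul [Fact p.Prime] (hp : p % 4 = 1)
    {x : HurwitzSeries R} (hx : solution 0 1 = solution 1 0 * x) :
    derivative^[p] x = (bigPi p : R) • 1 := by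
  have h := iterate_prime_derivation_mul derivative p (solution 1 0) x
  rw [← hx, iterate_derivative_solution_zero_one (by omega),
    iterate_derivative_solution_one_zero hp, mul_zero, add_zero] at h
  rw [← (isUnit_solution_one (0 : R)).mul_right_inj, ← h, mul_smul_comm, mul_one]

end CharP

theorem coeff_zero_of_solution_eq_mul {x : HurwitzSeries R}
    (hx : solution 0 1 = solution 1 0 * x) : coeff 0 x = 0 := by
  simpa [coeff_zero_mul, coeff_zero_solution] using (congrArg (coeff 0) hx).symm

theorem coeff_one_of_solution_eq_mul {x : HurwitzSeries R}
    (hx : solution 0 1 = solution 1 0 * x) : coeff 1 x = 1 := by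
  simpa [coeff_mul, coeff_zero_solution, coeff_one_solution,
    Nat.antidiagonal_succ] using (congrArg (coeff 1) hx).symm

theorem solution_eq_mul_map {x : HurwitzSeries R} (hx : solution 0 1 = solution 1 0 * x)
    (φ : R →+* S) : solution 0 1 = solution 1 0 * map φ x := by
  simpa [map_solution] using congrArg (map φ) hx

end Solution

section Hypergeometric

open PowerSeries (X expand)

theorem coeff_succ_hyp (a b c r : ℚ) (hc : 0 < c) (n : ℕ) :
    (n + 1) * (c + n) * PowerSeries.coeff (n + 1) (hyp a b c r) =
      (a + n) * (b + n) * r * PowerSeries.coeff n (hyp a b c r) := by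
  have hpoch : (ascPochhammer ℚ n).eval c ≠ 0 := (ascPochhammer_pos n c hc).ne'
  have hcn : c + n ≠ 0 := by positivity
  simp only [hyp, PowerSeries.coeff_mk, ascPochhammer_succ_eval, Nat.factorial_succ]
  push_cast
  field_simp
  ring

theorem constantCoeff_hyp (a b c r : ℚ) : PowerSeries.constantCoeff (hyp a b c r) = 1 := by
  simp [hyp, ← PowerSeries.coeff_zero_eq_constantCoeff_apply]

theorem coeff_even_X_mul_expand_two {R : Type*} [CommRing R] (f : R⟦X⟧) (m : ℕ) :
    PowerSeries.coeff (2 * m) (X * expand 2 two_ne_zero f) = 0 := by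
  cases m with
  | zero => simp
  | succ m =>
    rw [mul_add_one, PowerSeries.coeff_succ_X_mul,
      PowerSeries.coeff_expand_of_not_dvd _ _ _ (by omega)]

theorem coeff_odd_X_mul_expand_two {R : Type*} [CommRing R] (f : R⟦X⟧) (m : ℕ) :
    PowerSeries.coeff (2 * m + 1) (X * expand 2 two_ne_zero f) = PowerSeries.coeff m f := by
  rw [PowerSeries.coeff_succ_X_mul, PowerSeries.coeff_expand_mul]

theorem ofPowerSeries_denom :
    ofPowerSeries (expand 2 two_ne_zero (hyp (1 / 4) (1 / 4) (1 / 2) 4)) = solution 1 0 := by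
  refine eq_solution ?_ ?_ fun n ↦ ?_
  · simp [coeff_ofPowerSeries, constantCoeff_hyp]
  · simp [coeff_ofPowerSeries, PowerSeries.coeff_expand]
  · rw [coeff_ofPowerSeries, coeff_ofPowerSeries]
    obtain ⟨m, rfl | rfl⟩ := n.even_or_odd'
    · have h := coeff_succ_hyp (1 / 4) (1 / 4) (1 / 2) 4 (by norm_num) m
      rw [PowerSeries.coeff_expand_mul, ← mul_add_one, PowerSeries.coeff_expand_mul, mul_add_one,
        Nat.factorial_succ, Nat.factorial_succ]
      push_cast
      linear_combination 4 * ((2 * m).factorial : ℚ) * h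
    · rw [PowerSeries.coeff_expand_of_not_dvd _ _ _ (by omega),
        PowerSeries.coeff_expand_of_not_dvd _ _ _ (by omega)]
      ring

theorem ofPowerSeries_numer :
    ofPowerSeries (X * expand 2 two_ne_zero (hyp (3 / 4) (3 / 4) (3 / 2) 4)) = solution 0 1 := by
  refine eq_solution ?_ ?_ fun n ↦ ?_
  · rw [coeff_ofPowerSeries, ← mul_zero 2, coeff_even_X_mul_expand_two, mul_zero]
  · rw [coeff_ofPowerSeries, coeff_odd_X_mul_expand_two _ 0]
    simp [constantCoeff_hyp]
  · rw [coeff_ofPowerSeries, coeff_ofPowerSeries]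
    obtain ⟨m, rfl | rfl⟩ := n.even_or_odd'
    · rw [← mul_add_one, coeff_even_X_mul_expand_two, coeff_even_X_mul_expand_two]
      ring
    · have h := coeff_succ_hyp (3 / 4) (3 / 4) (3 / 2) 4 (by norm_num) m
      rw [add_right_comm, ← mul_add_one, coeff_odd_X_mul_expand_two, coeff_odd_X_mul_expand_two,
        mul_add_one, Nat.factorial_succ, Nat.factorial_succ]
      push_cast
      linear_combination 4 * ((2 * m + 1).factorial : ℚ) * h

theorem uSeries_eq : uSeries = X * expand 2 two_ne_zero
    (hyp (3 / 4) (3 / 4) (3 / 2) 4 * (hyp (1 / 4) (1 / 4) (1 / 2) 4)⁻¹) := by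
  ext n
  obtain ⟨m, rfl | rfl⟩ := n.even_or_odd'
  · rw [uSeries, PowerSeries.coeff_mk, if_neg (by simp), coeff_even_X_mul_expand_two]
  · rw [uSeries, PowerSeries.coeff_mk, if_pos (by simp), coeff_odd_X_mul_expand_two,
      Nat.add_sub_cancel, Nat.mul_div_cancel_left _ two_pos, u,
      mul_div_cancel_left₀ _ (by positivity)]

theorem solution_eq_mul_ofPowerSeries_uSeries :
    solution 0 1 = solution 1 0 * ofPowerSeries uSeries := by
  have hinv : hyp (1 / 4) (1 / 4) (1 / 2) 4 * (hyp (1 / 4) (1 / 4) (1 / 2) 4)⁻¹ = 1 :=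
    PowerSeries.mul_inv_cancel _ (by simp [constantCoeff_hyp])
  rw [← ofPowerSeries_denom, ← ofPowerSeries_numer, ← map_mul, uSeries_eq, mul_left_comm,
    ← map_mul, mul_left_comm, hinv, mul_one]

theorem s_eq_coeff_dividedPower {x : HurwitzSeries ℤ} (hx : solution 0 1 = solution 1 0 * x)
    (n k : ℕ) : ((coeff (2 * n) (dividedPower x (2 * k)) : ℤ) : ℚ) = s n k := by
  have hmap : map (Int.castRingHom ℚ) x = ofPowerSeries uSeries := by
    rw [← (isUnit_solution_one (0 : ℚ)).mul_right_inj, ← solution_eq_mul_ofPowerSeries_uSeries,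
      ← solution_eq_mul_map hx]
  have hpow := factorial_nsmul_dividedPower (2 * k)
    (coeff_zero_of_solution_eq_mul solution_eq_mul_ofPowerSeries_uSeries)
  have hcoeff := congrArg (coeff (2 * n)) hpow
  rw [map_nsmul, ← map_pow, coeff_ofPowerSeries, ← hmap, ← map_dividedPower, coeff_map,
    nsmul_eq_mul] at hcoeff
  rw [s, div_mul_eq_mul_div, eq_div_iff (by positivity), ← hcoeff, mul_comm]
  rfl

end Hypergeometric

theorem bigPi_cast_ne_zero {p : ℕ} [Fact p.Prime] (hp : p % 4 = 1) : (bigPi p : ZMod p) ≠ 0 := by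
  rw [bigPi, Int.cast_prod, prod_ne_zero_iff]
  intro i hi
  have hi := mem_Icc.1 hi
  rw [Int.cast_pow]
  refine pow_ne_zero 2 fun hzero ↦ ?_
  obtain ⟨c, hc⟩ := (ZMod.intCast_zmod_eq_zero_iff_dvd _ p).1 hzero
  -- `0 < 4i - 1 < 2p` forces `4i - 1 = p`, which is impossible modulo `4`
  have hc0 : 0 < c := by
    by_contra! h
    nlinarith
  have hc2 : c < 2 := by
    by_contra! h
    nlinarith [show (4 * i : ℤ) + 2 ≤ 2 * p by omega]
  obtain rfl : c = 1 := by omega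
  omega

/-- The factor of `s(n, k)` in the congruence, for `h = (p - 1) / 2`, `a = 2` and base `c`; it is
extended by zero to all `k`, so that the sum runs over an interval. -/
noncomputable def weight {K : Type*} [Field K] (a c : K) (h n : ℕ) (l : ℤ) (k : ℕ) : K :=
  if (k : ℤ) ≡ l [ZMOD h] then a ^ (n - k) * c ^ ((k - l) / h) else 0

theorem weight_add {K : Type*} [Field K] {a P : K} (ha : a ≠ 0) (hP : P ≠ 0) {h k n : ℕ}
    (h0 : h ≠ 0) (hk : k + h ≤ n) (l : ℤ) :
    weight a (-a ^ h * P) h n l (k + h) = -P * weight a (-a ^ h * P) h n l k := by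
  have hmod : ((k + h : ℕ) : ℤ) ≡ l [ZMOD h] ↔ (k : ℤ) ≡ l [ZMOD h] := by
    rw [Nat.cast_add, Int.ModEq, Int.add_emod_right, Int.ModEq]
  have hexp : ((k + h : ℕ) - l) / (h : ℤ) = (k - l) / h + 1 := by
    rw [Nat.cast_add, add_sub_right_comm, Int.add_ediv_of_dvd_right dvd_rfl,
      Int.ediv_self (by exact_mod_cast h0)]
  rw [weight, weight, if_congr hmod rfl rfl, hexp, zpow_add_one₀ (by simp [ha, hP]),
    show n - k = n - (k + h) + h by omega, pow_add, mul_ite, mul_zero]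
  congr 1
  ring

end ThetaTaylor

open HurwitzSeries ThetaTaylor

theorem lemma4p4 (p : ℕ) [Fact p.Prime] (hp : p % 4 = 1) (n : ℕ) (hn : (p + 1) / 2 ≤ n) (l : ℤ) :
    ∃ S : ℕ → ℤ, (∀ k ∈ Finset.Icc 1 n, (S k : ℚ) = ThetaTaylor.s n k) ∧
      ∑ k ∈ (Finset.Icc 1 n).filter (fun k : ℕ => (k : ℤ) ≡ l [ZMOD (((p - 1) / 2 : ℕ) : ℤ)]),
        (2 : ZMod p) ^ (n - k) * (S k : ZMod p) *
          (-2 ^ ((p - 1) / 2) * (ThetaTaylor.bigPi p : ZMod p)) ^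
            (2 * ((k : ℤ) - l) / ((p : ℤ) - 1)) = 0 := by
  have hp2 := (Fact.out : p.Prime).two_le
  generalize hh : (p - 1) / 2 = h
  have hph : p = 2 * h + 1 := by omega
  have h2 : (2 : ZMod p) ≠ 0 := by
    exact_mod_cast (CharP.cast_ne_zero_of_ne_of_prime (ZMod p) Nat.prime_two (p := p) (by omega))
  obtain ⟨x, hx⟩ := (isUnit_solution_one (0 : ℤ)).dvd (a := solution 0 1)
  have hxp := solution_eq_mul_map hx (Int.castRingHom (ZMod p))
  refine ⟨fun k ↦ coeff (2 * n) (dividedPower x (2 * k)),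
    fun k _ ↦ s_eq_coeff_dividedPower hx n k, ?_⟩
  have hsum := sum_mul_coeff_dividedPower_eq_zero hph (coeff_zero_of_solution_eq_mul hxp)
    (coeff_one_of_solution_eq_mul hxp) (iterate_derivative_of_solution_eq_mul hp hxp)
    (n := n) (by omega) fun k hk ↦ weight_add h2 (bigPi_cast_ne_zero hp) (by omega) hk l
  rw [sum_filter]
  refine (sum_congr rfl fun k _ ↦ ?_).trans hsum
  have hexp : 2 * ((k : ℤ) - l) / ((p : ℤ) - 1) = (k - l) / h := by
    rw [show (p : ℤ) - 1 = 2 * h by omega, Int.mul_ediv_mul_of_pos _ _ two_pos]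
  rw [hexp, ← map_dividedPower, coeff_map, weight, ite_mul, zero_mul, mul_right_comm]
  rfl
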